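/- Let $\mathcal H$ be an infinite-dimensional complex Hilbert space, let $q\ge 1$ and $p_0\ge 1$ be integers, and let $\mathbf A=(A_1,\dots,A_m)$ be an $m$-tuple of bounded self-adjoint operators on $\mathcal H$. For a Hilbert space $\mathcal G$, a tuple $\mathbf T=(T_1,\dots,T_m)$ of bounded operators on $\mathcal G$ and an integer $p\ge 1$, let $\Lambda_{p,q}(\mathbf T)$ be the set of all $m$-tuples $(B_1,\dots,B_m)$ of complex $q\times q$ matrices for which there are a $pq$-dimensional subspace $\mathcal K\subseteq\mathcal G$ and an operator $X:\mathcal K\to\mathcal G$ with $X^*X=I_{\mathcal K}$ such that, in one common orthonormal basis of $\mathcal K$, $X^*T_jX$ has the matrix $I_p\otimes B_j$ for all $j=1,\dots,m$. Let $\Lambda_{\infty,q}(\mathbf A)$ be the set of all $m$-tuples $(B_1,\dots,B_m)$ of complex $q\times q$ matrices for which there are an infinite-dimensional closed subspace $\mathcal K\subseteq\mathcal H$ and an operator $X:\mathcal K\to\mathcal H$ with $X^*X=I_{\mathcal K}$ such that, in one common orthonormal basis of $\mathcal K$, $X^*A_jX$ has the matrix $I_\infty\otimes B_j=B_j\oplus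 B_j\oplus B_j\oplus\cdots$ for all $j$. Let $S_{p,q}(\mathbf A)$ be the set of star-centers of $\Lambda_{p,q}(\mathbf A)$, that is, of those $\mathbf C\in\Lambda_{p,q}(\mathbf A)$ such that $t\mathbf C+(1-t)\mathbf B\in\Lambda_{p,q}(\mathbf A)$ for all $\mathbf B\in\Lambda_{p,q}(\mathbf A)$ and $0\le t\le 1$. Let $\mathcal V^\perp$ be the set of all operators $Y:\mathcal L^\perp\to\mathcal H$ with $Y^*Y=I_{\mathcal L^\perp}$, where $\mathcal L$ is a subspace of $\mathcal H$ of finite dimension $r\ge 1$, that extend to a unitary operator on $\mathcal H$ (equivalently, whose range also has codimension $r$). Let $\mathcal S_{\mathcal F}(\mathcal H)$ be the set of self-adjoint finite-rank operators on $\mathcal H$. Write $Y^*\mathbf AY=(Y^*A_1Y,\dots,Y^*A_mY)$, a tuple of operators on $\mathcal L^\perp$, and $\mathbf A+\mathbf F=(A_1+F_1,\dots,A_m+F_m)$. Then $$\Lambda_{\infty,q}(\mathbf A)=\bigcap_{p\ge 1}S_{p,q}(\mathbf A)=\bigcap_{p\ge 1}\Lambda_{p,q}(\mathbf A)=\bigcap\{\Lambda_{p_0,q}(Y^*\mathbf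 AY):Y\in\mathcal V^\perp\}=\bigcap\{\Lambda_{p_0,q}(\mathbf A+\mathbf F):\mathbf F\in\mathcal S_{\mathcal F}(\mathcal H)^m\}.$$ Consequently, $\Lambda_{\infty,q}(\mathbf A)$ is convex. -/

import Mathlib

open scoped Kronecker

noncomputable section

namespace MatricialRange

variable {H : Type*} [NormedAddCommGroup H] [InnerProductSpace ℂ H] [CompleteSpace H]

/-- `X* A X`, for operators `X : K → H` and `A : H → H`. -/
def compression {K : Type*} [NormedAddCommGroup K] [InnerProductSpace ℂ K] [CompleteSpace K]
    (X : K →L[ℂ] H) (A : H →L[ℂ] H) : K →L[ℂ] K :=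
  (ContinuousLinearMap.adjoint X) ∘L A ∘L X

/-- `X* X` is the identity of `K`. -/
def IsIsometric {K : Type*} [NormedAddCommGroup K] [InnerProductSpace ℂ K] [CompleteSpace K]
    (X : K →L[ℂ] H) : Prop :=
  (ContinuousLinearMap.adjoint X) ∘L X = ContinuousLinearMap.id ℂ K

/-- The tuples `(B_1, …, B_m)` of `q × q` matrices such that, for one isometric `X : K → H`
defined on a closed subspace `K` of `H` and one orthonormal (Hilbert) basis of `K` indexed by
`ι × Fin q`, the matrix of `X* A_j X` in this basis is `I_ι ⊗ B_j` for all `j`.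
If `ι` is finite, the basis is an ordinary orthonormal basis and `dim K = |ι| q`. -/
def rangeOver (ι : Type*) [DecidableEq ι] {m : ℕ} (q : ℕ) (A : Fin m → H →L[ℂ] H) :
    Set (Fin m → Matrix (Fin q) (Fin q) ℂ) :=
  {B | ∃ (K : Submodule ℂ H) (_ : CompleteSpace K) (X : K →L[ℂ] H)
      (b : HilbertBasis (ι × Fin q) ℂ K), IsIsometric X ∧
      ∀ j : Fin m, ∀ s t : ι × Fin q,
        inner ℂ (b s) (compression X (A j) (b t)) = ((1 : Matrix ι ι ℂ) ⊗ₖ B j) s t}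

/-- The joint `(p,q)`-matricial range `Λ_{p,q}(A)`, for `p, q ≥ 1`. -/
def Lam {m : ℕ} (p q : ℕ) (A : Fin m → H →L[ℂ] H) : Set (Fin m → Matrix (Fin q) (Fin q) ℂ) :=
  rangeOver (Fin p) q A

/-- The joint `(∞,q)`-matricial range `Λ_{∞,q}(A)`, for `q ≥ 1`:
here `I_∞ ⊗ B_j = B_j ⊕ B_j ⊕ ⋯`. -/
def LamInfty {m : ℕ} (q : ℕ) (A : Fin m → H →L[ℂ] H) :
    Set (Fin m → Matrix (Fin q) (Fin q) ℂ) :=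
  rangeOver ℕ q A

/-- The set of star-centers of `S`; a star-center is by definition an element of `S`. -/
def starCenters {V : Type*} [AddCommGroup V] [Module ℝ V] (S : Set V) : Set V :=
  {s₀ | s₀ ∈ S ∧ ∀ s ∈ S, ∀ t : ℝ, 0 ≤ t → t ≤ 1 → t • s₀ + (1 - t) • s ∈ S}

/-- `Y : Lᗮ → H` belongs to `𝒱^⊥`: the subspace `L` has finite dimension `r ≥ 1`, `Y* Y` is the
identity of `Lᗮ`, and `Y` is the restriction of a unitary operator on `H` (that is, the range
of `Y` has codimension `r` as well; this is automatic only when `H` is finite-dimensional). -/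
def IsFiniteCodimIsometry (L : Submodule ℂ H) (Y : Lᗮ →L[ℂ] H) : Prop :=
  FiniteDimensional ℂ L ∧ 1 ≤ Module.finrank ℂ L ∧ IsIsometric Y ∧
    ∃ U ∈ unitary (H →L[ℂ] H), ∀ x : Lᗮ, U (x : H) = Y x

/-- `F` is self-adjoint and of finite rank. -/
def IsFiniteRankSelfAdjoint (F : H →L[ℂ] H) : Prop :=
  IsSelfAdjoint F ∧ FiniteDimensional ℂ (LinearMap.range (F : H →ₗ[ℂ] H))

end MatricialRange

end

-- All the sets are compared with one condition, `RealizableAwayFromFinite`: a single block with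
-- matrices `B` can be found orthogonal to any prescribed finite-dimensional subspace. Since the `A
-- j` are self-adjoint, such blocks can be stacked with zero cross terms (`exists_seq_blocks`), so
-- the condition gives `I_∞ ⊗ B`. Conversely, a dimension count extracts a block orthogonal to `M`
-- from `I_p ⊗ B` once `p` is large (`exists_block_of_mem_Lam`).
--
-- Under this condition, copies of `B` can also avoid any finite-dimensional obstruction: a given
-- realization of another tuple, which yields star-centers and hence convexity, the subspace removed
-- by a compression, or the ranges of a perturbation.
--
-- Conversely, finite-codimensional compressions give the condition directly, by taking inclusions.
-- For perturbations, `F` is chosen so that `A + F` is scalar on a large finite-dimensional `N`. The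
-- `N`-components of a block for `A + F` are then moved isometrically onto a subspace of `N`,
-- orthogonal to `M`, where `A` itself compresses to the same scalars. Such a subspace exists by
-- Radon's theorem (`exists_scalar_block`).

open MatricialRange Submodule

namespace MatricialRange

variable {H : Type*} [NormedAddCommGroup H] [InnerProductSpace ℂ H]

-- Matricial ranges in terms of orthonormal families

/-- `x` is an orthonormal family in which the tuple `A` has the matrices `C`. -/
def Realizes {κ : Type*} {m : ℕ} (A : Fin m → H →L[ℂ] H) (C : Fin m → Matrix κ κ ℂ)
    (x : κ → H) : Prop :=
  Orthonormal ℂ x ∧ ∀ j s t, inner ℂ (x s) (A j (x t)) = C j s t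

/-- Orthogonally to every finite-dimensional subspace, `A` has a compression with matrices `C`. -/
def RealizableAwayFromFinite {κ : Type*} {m : ℕ} (A : Fin m → H →L[ℂ] H)
    (C : Fin m → Matrix κ κ ℂ) : Prop :=
  ∀ M : Submodule ℂ H, FiniteDimensional ℂ M → ∃ x : κ → H, (∀ s, x s ∈ Mᗮ) ∧ Realizes A C x

theorem inner_map_map_of_isIsometric [CompleteSpace H] {K : Type*} [NormedAddCommGroup K]
    [InnerProductSpace ℂ K] [CompleteSpace K] {X : K →L[ℂ] H} (hX : IsIsometric X) (u v : K) :
    inner ℂ (X u) (X v) = inner ℂ u v := by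
  have := congrArg (fun T : K →L[ℂ] K => T v) hX
  simp only [ContinuousLinearMap.comp_apply, ContinuousLinearMap.id_apply] at this
  rw [← ContinuousLinearMap.adjoint_inner_right, this]

theorem realizes_compression_iff [CompleteSpace H] {K : Type*} [NormedAddCommGroup K]
    [InnerProductSpace ℂ K] [CompleteSpace K] {X : K →L[ℂ] H} (hX : IsIsometric X)
    {κ : Type*} {m : ℕ} {A : Fin m → H →L[ℂ] H} {C : Fin m → Matrix κ κ ℂ} {x : κ → K} :
    Realizes (fun j => compression X (A j)) C x ↔ Realizes A C (fun s => X (x s)) := by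
  classical
  refine and_congr ?_ ?_
  · simp only [orthonormal_iff_ite, inner_map_map_of_isIsometric hX]
  · simp only [compression, ContinuousLinearMap.comp_apply,
      ContinuousLinearMap.adjoint_inner_right]

theorem isIsometric_subtypeL [CompleteSpace H] (K : Submodule ℂ H) [CompleteSpace K] :
    IsIsometric K.subtypeL := by
  ext1 v
  refine ext_inner_left ℂ fun u => ?_
  rw [ContinuousLinearMap.comp_apply, ContinuousLinearMap.adjoint_inner_right]
  rfl

/-- The data `K`, `X`, `b` matter only through the family `X (b s)`; in the other direction the
inclusion of the closed span serves as `X`. -/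
theorem mem_rangeOver_iff [CompleteSpace H] {ι : Type*} [DecidableEq ι] {m q : ℕ}
    {A : Fin m → H →L[ℂ] H} {B : Fin m → Matrix (Fin q) (Fin q) ℂ} :
    B ∈ rangeOver ι q A ↔
      ∃ x : ι × Fin q → H, Realizes A (fun j => (1 : Matrix ι ι ℂ) ⊗ₖ B j) x := by
  constructor
  · rintro ⟨K, _, X, b, hX, hb⟩
    exact ⟨fun s => X (b s), (realizes_compression_iff hX).1 ⟨b.orthonormal, hb⟩⟩
  · rintro ⟨x, hx, hC⟩
    let K : Submodule ℂ H := (span ℂ (Set.range x)).topologicalClosure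
    have hK : CompleteSpace K :=
      (span ℂ (Set.range x)).isClosed_topologicalClosure.completeSpace_coe
    have hmem : ∀ s, x s ∈ K := fun s => le_topologicalClosure _ (subset_span ⟨s, rfl⟩)
    have hv : Orthonormal ℂ (fun s => (⟨x s, hmem s⟩ : K)) := by
      classical
      rw [orthonormal_iff_ite] at hx ⊢
      exact hx
    have hbot : (span ℂ (Set.range fun s => (⟨x s, hmem s⟩ : K)))ᗮ = ⊥ := by
      rw [eq_bot_iff]
      intro y hy
      have hyp : (y : H) ∈ Kᗮ := by
        rw [orthogonal_closure, mem_orthogonal]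
        intro u hu
        induction hu using span_induction with
        | mem u hu =>
          obtain ⟨s, rfl⟩ := hu
          exact (mem_orthogonal _ _).1 hy ⟨x s, hmem s⟩ (subset_span ⟨s, rfl⟩)
        | zero => simp
        | add u v _ _ hu hv => rw [inner_add_left, hu, hv, add_zero]
        | smul c u _ hu => rw [inner_smul_left, hu, mul_zero]
      have : (y : H) = 0 := by
        have := (mem_orthogonal _ _).1 hyp y y.2
        exact inner_self_eq_zero.1 this
      exact (mem_bot ℂ).2 (Subtype.ext this)
    refine ⟨K, hK, K.subtypeL, HilbertBasis.mkOfOrthogonalEqBot hv hbot,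
      isIsometric_subtypeL K, fun j s t => ?_⟩
    rw [compression, ContinuousLinearMap.comp_apply, ContinuousLinearMap.adjoint_inner_right,
      HilbertBasis.coe_mkOfOrthogonalEqBot]
    exact hC j s t

-- Stacking blocks

/-- Blocks available away from every finite-dimensional subspace can be chosen successively,
mutually orthogonal and with vanishing cross terms for `A`. -/
theorem exists_seq_blocks [CompleteSpace H] {κ : Type*} [Finite κ] {m : ℕ}
    {A : Fin m → H →L[ℂ] H}
    (hA : ∀ j, IsSelfAdjoint (A j)) {P : (κ → H) → Prop}
    (hP : ∀ M : Submodule ℂ H, FiniteDimensional ℂ M → ∃ x : κ → H, (∀ s, x s ∈ Mᗮ) ∧ P x)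
    (M : Submodule ℂ H) [FiniteDimensional ℂ M] :
    ∃ x : ℕ → κ → H, (∀ i s, x i s ∈ Mᗮ) ∧ (∀ i, P (x i)) ∧
      (∀ i i' s t, i ≠ i' → inner ℂ (x i s) (x i' t) = 0) ∧
      ∀ j i i' s t, i ≠ i' → inner ℂ (x i s) (A j (x i' t)) = 0 := by
  choose! f hf hfP using hP
  -- Later blocks must avoid the images under each `A j` as well as the vectors; self-adjointness
  -- then kills the cross terms in both orders.
  let ext : (κ → H) → Submodule ℂ H := fun x =>
    span ℂ (Set.range x) ⊔ span ℂ (Set.range fun p : Fin m × κ => A p.1 (x p.2))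
  have hext : ∀ x, FiniteDimensional ℂ (ext x) := fun x => by
    have h1 := FiniteDimensional.span_of_finite ℂ (Set.finite_range x)
    have h2 := FiniteDimensional.span_of_finite ℂ
      (Set.finite_range fun p : Fin m × κ => A p.1 (x p.2))
    exact Submodule.finiteDimensional_sup _ _
  let N : ℕ → Submodule ℂ H := fun n =>
    Nat.rec (motive := fun _ => Submodule ℂ H) M (fun _ L => L ⊔ ext (f L)) n
  have hN : ∀ n, N (n + 1) = N n ⊔ ext (f (N n)) := fun n => rfl
  have hfin : ∀ n, FiniteDimensional ℂ (N n) := by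
    intro n
    induction n with
    | zero => assumption
    | succ n ih =>
      have := hext (f (N n))
      rw [hN]
      exact Submodule.finiteDimensional_sup _ _
  have hmono : Monotone N := monotone_nat_of_le_succ fun n => by rw [hN]; exact le_sup_left
  have hx : ∀ i s, f (N i) s ∈ N (i + 1) := fun i s => by
    rw [hN]
    exact mem_sup_right (mem_sup_left (subset_span ⟨s, rfl⟩))
  have hAx : ∀ j i s, A j (f (N i) s) ∈ N (i + 1) := fun j i s => by
    rw [hN]
    exact mem_sup_right (mem_sup_right (subset_span ⟨(j, s), rfl⟩))
  have key : ∀ i i' t, i < i' → ∀ v ∈ N (i + 1), inner ℂ v (f (N i') t) = 0 :=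
    fun i i' t h v hv => (mem_orthogonal _ _).1 (hf (N i') (hfin i') t) v (hmono h hv)
  refine ⟨fun i => f (N i), fun i s => ?_, fun i => hfP _ (hfin i), fun i i' s t h => ?_,
    fun j i i' s t h => ?_⟩
  · exact orthogonal_le (hmono (Nat.zero_le i)) (hf (N i) (hfin i) s)
  · rcases lt_or_gt_of_ne h with h | h
    · exact key i i' t h _ (hx i s)
    · rw [inner_eq_zero_symm]
      exact key i' i s h _ (hx i' t)
  · rcases lt_or_gt_of_ne h with h | h
    · rw [← (hA j).isSymmetric.apply_clm]
      exact key i i' t h _ (hAx j i s)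
    · rw [inner_eq_zero_symm]
      exact key i' i s h _ (hAx j i' t)

theorem Realizes.restrict {κ κ' : Type*} {m : ℕ} {A : Fin m → H →L[ℂ] H}
    {C : Fin m → Matrix κ κ ℂ} {x : κ → H} (hx : Realizes A C x) {e : κ' → κ}
    (he : Function.Injective e) : Realizes A (fun j => (C j).submatrix e e) (x ∘ e) :=
  ⟨hx.1.comp e he, fun j s t => hx.2 j (e s) (e t)⟩

theorem realizes_one_kronecker {ι κ : Type*} [DecidableEq ι] {m : ℕ} {A : Fin m → H →L[ℂ] H}
    {C : Fin m → Matrix κ κ ℂ} {x : ι → κ → H} (hx : ∀ i, Realizes A C (x i))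
    (ho : ∀ i i' s t, i ≠ i' → inner ℂ (x i s) (x i' t) = 0)
    (hA : ∀ j i i' s t, i ≠ i' → inner ℂ (x i s) (A j (x i' t)) = 0) :
    Realizes A (fun j => (1 : Matrix ι ι ℂ) ⊗ₖ C j) (fun p : ι × κ => x p.1 p.2) := by
  classical
  refine ⟨orthonormal_iff_ite.2 ?_, ?_⟩
  · rintro ⟨i, s⟩ ⟨i', t⟩
    by_cases h : i = i'
    · subst h
      simpa using orthonormal_iff_ite.1 (hx i).1 s t
    · simp [ho i i' s t h, h]
  · rintro j ⟨i, s⟩ ⟨i', t⟩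
    by_cases h : i = i'
    · subst h
      simpa using (hx i).2 j s t
    · simp [hA j i i' s t h, h]

/-- Used with `T` the identity for Gram matrices and with `T = A j` for compressions. -/
theorem inner_sum_smul_of_offDiag {ι : Type*} [Fintype ι] (T : H →L[ℂ] H) {x y : ι → H} {c : ι → ℂ}
    (hd : ∀ i, inner ℂ (x i) (T (y i)) = c i)
    (ho : ∀ i i', i ≠ i' → inner ℂ (x i) (T (y i')) = 0) (a b : ι → ℂ) :
    inner ℂ (∑ i, a i • x i) (T (∑ i, b i • y i)) = ∑ i, star (a i) * b i * c i := by
  rw [map_sum, sum_inner]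
  refine Finset.sum_congr rfl fun i _ => ?_
  rw [inner_sum, Finset.sum_eq_single i (fun i' _ h => ?_) (by simp)]
  · rw [map_smul, inner_smul_left, inner_smul_right, hd]
    simp [mul_assoc]
  · rw [map_smul, inner_smul_left, inner_smul_right, ho i i' h.symm]
    simp

theorem RealizableAwayFromFinite.exists_family [CompleteSpace H] {ι κ : Type*} [DecidableEq ι]
    [Countable ι] [Finite κ] {m : ℕ} {A : Fin m → H →L[ℂ] H} (hA : ∀ j, IsSelfAdjoint (A j))
    {C : Fin m → Matrix κ κ ℂ} (hC : RealizableAwayFromFinite A C)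
    (M : Submodule ℂ H) [FiniteDimensional ℂ M] :
    ∃ x : ι × κ → H, (∀ s, x s ∈ Mᗮ) ∧
      Realizes A (fun j => (1 : Matrix ι ι ℂ) ⊗ₖ C j) x := by
  obtain ⟨e, he⟩ := exists_injective_nat ι
  obtain ⟨x, hxM, hx, ho, hxA⟩ := exists_seq_blocks hA hC M
  exact ⟨fun p => x (e p.1) p.2, fun s => hxM _ _,
    realizes_one_kronecker (x := fun i => x (e i)) (fun i => hx _)
      (fun i i' s t h => ho _ _ s t (he.ne h)) fun j i i' s t h => hxA j _ _ s t (he.ne h)⟩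

-- The infinite range and the finite ranges

theorem LamInfty_subset_Lam [CompleteSpace H] {m : ℕ} (p q : ℕ) (A : Fin m → H →L[ℂ] H) :
    LamInfty q A ⊆ Lam p q A := by
  intro B hB
  obtain ⟨x, hx⟩ := mem_rangeOver_iff.1 hB
  refine mem_rangeOver_iff.2 ⟨fun s => x (s.1, s.2), ?_⟩
  have := hx.restrict (e := fun s : Fin p × Fin q => ((s.1 : ℕ), s.2)) (fun s t h => by
    simp only [Prod.mk.injEq, Fin.val_inj] at h
    exact Prod.ext h.1 h.2)
  have hC : (fun j => ((1 : Matrix ℕ ℕ ℂ) ⊗ₖ B j).submatrix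
      (fun s : Fin p × Fin q => ((s.1 : ℕ), s.2)) (fun s => ((s.1 : ℕ), s.2))) =
      fun j => (1 : Matrix (Fin p) (Fin p) ℂ) ⊗ₖ B j := by
    ext j ⟨i, s⟩ ⟨i', t⟩
    simp [Matrix.one_apply, Fin.val_inj]
  rwa [hC] at this

/-- In `ℂ^p ⊗ ℂ^q`, each slice `v ⊗ ℂ^q` with `v` a unit vector carries a copy of `B`. Orthogonality
of the slice to `M` amounts to `q * finrank M` linear conditions on `v`, fewer than `p`. -/
theorem exists_block_of_mem_Lam [CompleteSpace H] {m p q : ℕ} {A : Fin m → H →L[ℂ] H}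
    {B : Fin m → Matrix (Fin q) (Fin q) ℂ} (hB : B ∈ Lam p q A) (M : Submodule ℂ H)
    [FiniteDimensional ℂ M] (hp : q * Module.finrank ℂ M < p) :
    ∃ x : Fin q → H, (∀ s, x s ∈ Mᗮ) ∧ Realizes A B x := by
  obtain ⟨x, hx⟩ := mem_rangeOver_iff.1 hB
  let comb : Fin q → EuclideanSpace ℂ (Fin p) →ₗ[ℂ] H := fun s =>
    { toFun := fun v => ∑ i, v i • x (i, s)
      map_add' := fun v w => by simp [add_smul, Finset.sum_add_distrib]
      map_smul' := fun c v => by simp [mul_smul, Finset.smul_sum] }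
  have hker := LinearMap.ker_ne_bot_of_finrank_lt
    (f := LinearMap.pi fun s => (M.orthogonalProjectionOnto : H →ₗ[ℂ] M) ∘ₗ comb s) (by
      rw [Module.finrank_pi_fintype]
      simpa using hp)
  obtain ⟨v, hv, hv0⟩ := (Submodule.ne_bot_iff _).1 hker
  let w : EuclideanSpace ℂ (Fin p) := ((‖v‖⁻¹ : ℝ) : ℂ) • v
  have hw : ∑ i, star (w i) * w i = 1 := by
    have h1 : ‖w‖ = 1 := by
      simp only [w]
      push_cast
      exact norm_smul_inv_norm hv0
    have h2 : inner ℂ w w = 1 := by rw [inner_self_eq_norm_sq_to_K, h1]; simp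
    rw [← h2, PiLp.inner_apply]
    exact Finset.sum_congr rfl fun i _ => mul_comm _ _
  have hwker : ∀ s, M.orthogonalProjectionOnto (comb s w) = 0 := fun s => by
    have := congrFun (LinearMap.mem_ker.1 hv) s
    simp only [LinearMap.pi_apply, LinearMap.comp_apply, Pi.zero_apply] at this
    simp only [w, map_smul]
    erw [this]
    simp
  refine ⟨fun s => comb s w, fun s => ?_, ?_, fun j s t => ?_⟩
  · exact orthogonalProjectionOnto_eq_zero_iff.1 (hwker s)
  · classical
    rw [orthonormal_iff_ite]
    intro s t
    have ho := orthonormal_iff_ite.1 hx.1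
    have := inner_sum_smul_of_offDiag (ContinuousLinearMap.id ℂ H) (x := fun i => x (i, s))
      (y := fun i => x (i, t)) (c := fun _ => if s = t then 1 else 0)
      (fun i => by simpa using ho (i, s) (i, t))
      (fun i i' h => by simpa [h] using ho (i, s) (i', t)) w w
    rw [← Finset.sum_mul, hw, one_mul] at this
    exact this
  · have := inner_sum_smul_of_offDiag (A j) (x := fun i => x (i, s))
      (y := fun i => x (i, t)) (c := fun _ => B j s t)
      (fun i => by simpa using hx.2 j (i, s) (i, t))
      (fun i i' h => by simpa [h] using hx.2 j (i, s) (i', t)) w w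
    rw [← Finset.sum_mul, hw, one_mul] at this
    exact this

theorem mem_LamInfty_iff [CompleteSpace H] {m q : ℕ} {A : Fin m → H →L[ℂ] H}
    (hA : ∀ j, IsSelfAdjoint (A j)) {B : Fin m → Matrix (Fin q) (Fin q) ℂ} :
    B ∈ LamInfty q A ↔ RealizableAwayFromFinite A B := by
  refine ⟨fun h M hM => exists_block_of_mem_Lam (LamInfty_subset_Lam _ q A h) M
    (Nat.lt_succ_self _), fun h => ?_⟩
  obtain ⟨x, -, hx⟩ := h.exists_family hA (ι := ℕ) ⊥
  exact mem_rangeOver_iff.2 ⟨x, hx⟩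

theorem mem_LamInfty_iff_forall_mem_Lam [CompleteSpace H] {m q : ℕ} {A : Fin m → H →L[ℂ] H}
    (hA : ∀ j, IsSelfAdjoint (A j)) {B : Fin m → Matrix (Fin q) (Fin q) ℂ} :
    B ∈ LamInfty q A ↔ ∀ p, 1 ≤ p → B ∈ Lam p q A :=
  ⟨fun h p _ => LamInfty_subset_Lam p q A h, fun h => (mem_LamInfty_iff hA).2 fun M _ =>
    exists_block_of_mem_Lam (h (q * Module.finrank ℂ M + 1) (by omega)) M (Nat.lt_succ_self _)⟩

-- Star-centers

theorem LamInfty_subset_starCenters [CompleteSpace H] {m : ℕ} (p q : ℕ) {A : Fin m → H →L[ℂ] H}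
    (hA : ∀ j, IsSelfAdjoint (A j)) : LamInfty q A ⊆ starCenters (Lam p q A) := by
  intro B hB
  refine ⟨LamInfty_subset_Lam p q A hB, fun C hC t ht0 ht1 => ?_⟩
  obtain ⟨x, hx⟩ := mem_rangeOver_iff.1 hC
  -- A copy `y` of `I_p ⊗ B` orthogonal to this `M` has no cross terms with `x`, so `√t y + √(1-t)
  -- x` realizes the convex combination.
  let M : Submodule ℂ H := span ℂ (Set.range x) ⊔
    span ℂ (Set.range fun p : Fin m × (Fin p × Fin q) => A p.1 (x p.2))
  have hM : FiniteDimensional ℂ M := by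
    have h1 := FiniteDimensional.span_of_finite ℂ (Set.finite_range x)
    have h2 := FiniteDimensional.span_of_finite ℂ
      (Set.finite_range fun p : Fin m × (Fin p × Fin q) => A p.1 (x p.2))
    exact Submodule.finiteDimensional_sup _ _
  obtain ⟨y, hyM, hy⟩ := ((mem_LamInfty_iff hA).1 hB).exists_family hA (ι := Fin p) M
  have hxy : ∀ a b, inner ℂ (x a) (y b) = 0 := fun a b =>
    (mem_orthogonal _ _).1 (hyM b) _ (mem_sup_left (subset_span ⟨a, rfl⟩))
  have hyx : ∀ a b, inner ℂ (y a) (x b) = 0 := fun a b => inner_eq_zero_symm.1 (hxy b a)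
  have hAxy : ∀ j a b, inner ℂ (A j (x a)) (y b) = 0 := fun j a b =>
    (mem_orthogonal _ _).1 (hyM b) _ (mem_sup_right (subset_span ⟨(j, a), rfl⟩))
  have hyAx : ∀ j a b, inner ℂ (y a) (A j (x b)) = 0 := fun j a b =>
    inner_eq_zero_symm.1 (hAxy j b a)
  have hxAy : ∀ j a b, inner ℂ (x a) (A j (y b)) = 0 := fun j a b => by
    rw [← (hA j).isSymmetric.apply_clm, hAxy]
  have hst : ((√t : ℝ) : ℂ) * ((√t : ℝ) : ℂ) = (t : ℂ) := by
    rw [← Complex.ofReal_mul, Real.mul_self_sqrt ht0]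
  have hst' : ((√(1 - t) : ℝ) : ℂ) * ((√(1 - t) : ℝ) : ℂ) = 1 - (t : ℂ) := by
    rw [← Complex.ofReal_mul, Real.mul_self_sqrt (by linarith)]
    simp
  refine mem_rangeOver_iff.2
    ⟨fun s => ((√t : ℝ) : ℂ) • y s + ((√(1 - t) : ℝ) : ℂ) • x s, ?_, fun j a b => ?_⟩
  · have h1 := orthonormal_iff_ite.1 hx.1
    have h2 := orthonormal_iff_ite.1 hy.1
    rw [orthonormal_iff_ite]
    intro a b
    simp only [inner_add_left, inner_add_right, inner_smul_left, inner_smul_right, hxy, hyx,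
      h1, h2, Complex.conj_ofReal]
    linear_combination (if a = b then 1 else 0) * (hst + hst')
  · simp only [map_add, map_smul, inner_add_left, inner_add_right, inner_smul_left,
      inner_smul_right, hyAx, hxAy, hx.2, hy.2, Complex.conj_ofReal]
    obtain ⟨i, s⟩ := a
    obtain ⟨i', u⟩ := b
    simp only [Matrix.kroneckerMap_apply, Pi.add_apply, Pi.smul_apply, Matrix.add_apply,
      Matrix.smul_apply, Complex.real_smul, Complex.ofReal_sub, Complex.ofReal_one]
    linear_combination ((1 : Matrix (Fin p) (Fin p) ℂ) i i' * B j s u) * hst +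
      ((1 : Matrix (Fin p) (Fin p) ℂ) i i' * C j s u) * hst'

-- Stability under compression and finite-rank perturbation

theorem LamInfty_subset_Lam_compression [CompleteSpace H] {m : ℕ} (p q : ℕ)
    {A : Fin m → H →L[ℂ] H} (hA : ∀ j, IsSelfAdjoint (A j)) {L : Submodule ℂ H}
    {Y : Lᗮ →L[ℂ] H} (hY : IsFiniteCodimIsometry L Y) :
    LamInfty q A ⊆ Lam p q (fun j => compression Y (A j)) := by
  intro B hB
  obtain ⟨_, -, hYi, U, hU, hUY⟩ := hY
  -- Vectors orthogonal to `U L` are pulled back by `star U` into `Lᗮ`, where `Y` returns them to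
  -- `x`.
  obtain ⟨x, hxM, hx⟩ := ((mem_LamInfty_iff hA).1 hB).exists_family hA (ι := Fin p)
    (L.map (U : H →ₗ[ℂ] H))
  have hmem : ∀ s, (star U) (x s) ∈ Lᗮ := fun s => by
    rw [mem_orthogonal]
    intro u hu
    rw [ContinuousLinearMap.star_eq_adjoint, ContinuousLinearMap.adjoint_inner_right]
    exact (mem_orthogonal _ _).1 (hxM s) _ (mem_map_of_mem hu)
  refine mem_rangeOver_iff.2 ⟨fun s => ⟨_, hmem s⟩, (realizes_compression_iff hYi).2 ?_⟩
  convert hx using 2 with s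
  rw [← hUY]
  exact congrArg (fun T : H →L[ℂ] H => T (x s)) (Unitary.mul_star_self_of_mem hU)

theorem LamInfty_subset_Lam_add [CompleteSpace H] {m : ℕ} (p q : ℕ)
    {A F : Fin m → H →L[ℂ] H} (hA : ∀ j, IsSelfAdjoint (A j))
    (hF : ∀ j, IsFiniteRankSelfAdjoint (F j)) :
    LamInfty q A ⊆ Lam p q (fun j => A j + F j) := by
  intro B hB
  have := fun j => (hF j).2
  obtain ⟨x, hxM, hx⟩ := ((mem_LamInfty_iff hA).1 hB).exists_family hA (ι := Fin p)
    (⨆ j, LinearMap.range (F j : H →ₗ[ℂ] H))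
  refine mem_rangeOver_iff.2 ⟨x, hx.1, fun j s t => ?_⟩
  have h0 : inner ℂ (x s) (F j (x t)) = 0 := inner_eq_zero_symm.1
    ((mem_orthogonal _ _).1 (hxM s) _ (mem_iSup_of_mem j ⟨x t, rfl⟩))
  rw [_root_.add_apply, inner_add_right, h0, add_zero, hx.2]

-- Recovering blocks from compressions

theorem exists_block_of_mem_Lam_of_pos [CompleteSpace H] {m p q : ℕ} (hp : 1 ≤ p)
    {A : Fin m → H →L[ℂ] H} {B : Fin m → Matrix (Fin q) (Fin q) ℂ} (hB : B ∈ Lam p q A) :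
    ∃ x : Fin q → H, Realizes A B x := by
  obtain ⟨x, -, hx⟩ := exists_block_of_mem_Lam hB ⊥ (by simpa using Nat.lt_of_succ_le hp)
  exact ⟨x, hx⟩

theorem exists_unit_mem_orthogonal (hH : ¬ FiniteDimensional ℂ H) (M : Submodule ℂ H)
    [FiniteDimensional ℂ M] : ∃ y ∈ Mᗮ, ‖y‖ = 1 := by
  have hne : Mᗮ ≠ ⊥ := fun h => hH <| by
    rw [orthogonal_eq_bot_iff] at h
    subst h
    exact Module.Finite.of_surjective (⊤ : Submodule ℂ H).subtype fun y => ⟨⟨y, trivial⟩, rfl⟩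
  obtain ⟨v, hv, hv0⟩ := (Submodule.ne_bot_iff _).1 hne
  exact ⟨((‖v‖ : ℂ)⁻¹) • v, smul_mem _ _ hv, norm_smul_inv_norm hv0⟩

theorem realizableAwayFromFinite_of_forall_compression [CompleteSpace H]
    (hH : ¬ FiniteDimensional ℂ H) {m p q : ℕ} (hp : 1 ≤ p)
    {A : Fin m → H →L[ℂ] H} {B : Fin m → Matrix (Fin q) (Fin q) ℂ}
    (hB : ∀ (L : Submodule ℂ H) (Y : Lᗮ →L[ℂ] H), IsFiniteCodimIsometry L Y →
      B ∈ Lam p q (fun j => compression Y (A j))) : RealizableAwayFromFinite A B := by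
  intro M hM
  obtain ⟨y, -, hy⟩ := exists_unit_mem_orthogonal hH M
  have hy0 : y ≠ 0 := fun h => by simp [h] at hy
  -- The extra unit vector ensures `L ≠ ⊥` even when `M = ⊥`.
  let L := M ⊔ span ℂ {y}
  have hL : FiniteDimensional ℂ L := Submodule.finiteDimensional_sup _ _
  have hrank : 1 ≤ Module.finrank ℂ L := by
    refine Submodule.one_le_finrank_iff.2 fun h => hy0 ?_
    have : y ∈ L := mem_sup_right (mem_span_singleton_self y)
    rw [h] at this
    exact (mem_bot ℂ).1 this
  obtain ⟨x, hx⟩ := exists_block_of_mem_Lam_of_pos hp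
    (hB L Lᗮ.subtypeL ⟨hL, hrank, isIsometric_subtypeL _, 1, one_mem _, fun _ => rfl⟩)
  exact ⟨fun s => x s, fun s => orthogonal_le le_sup_left (x s).2,
    (realizes_compression_iff (isIsometric_subtypeL _)).1 hx⟩

-- Scalar compressions through Radon's theorem

theorem exists_weights_of_mem_convexHull_image {ι E : Type*} [Fintype ι] [AddCommGroup E]
    [Module ℝ E] {f : ι → E} {I : Set ι} {c : E} (hc : c ∈ convexHull ℝ (f '' I)) :
    ∃ w : ι → ℝ, (∀ i, 0 ≤ w i) ∧ (∀ i, i ∉ I → w i = 0) ∧ ∑ i, w i = 1 ∧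
      ∑ i, w i • f i = c := by
  classical
  refine convexHull_min (s := f '' I) (t := {c | ∃ w : ι → ℝ, (∀ i, 0 ≤ w i) ∧
    (∀ i, i ∉ I → w i = 0) ∧ ∑ i, w i = 1 ∧ ∑ i, w i • f i = c}) ?_ ?_ hc
  · rintro _ ⟨i, hi, rfl⟩
    refine ⟨Pi.single i 1, fun k => ?_, fun k hk => ?_, by simp, ?_⟩
    · rw [Pi.single_apply]; split_ifs <;> norm_num
    · exact Pi.single_eq_of_ne (M := fun _ => ℝ) (fun h => hk (by rwa [h])) _
    · simp [Pi.single_apply]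
  · rintro _ ⟨w, h0, hI, h1, rfl⟩ _ ⟨w', h0', hI', h1', rfl⟩ a b ha hb hab
    refine ⟨fun i => a * w i + b * w' i, fun i => ?_, fun i hi => ?_, ?_, ?_⟩
    · have := h0 i
      have := h0' i
      positivity
    · simp [hI i hi, hI' i hi]
    · rw [Finset.sum_add_distrib, ← Finset.mul_sum, ← Finset.mul_sum, h1, h1', mul_one, mul_one,
        hab]
    · simp [add_smul, mul_smul, Finset.sum_add_distrib, Finset.smul_sum]

/-- Radon's theorem with explicit weights, indexed by the two parts of the partition. -/
theorem exists_radon_weights {m : ℕ} (f : Fin (m + 2) → Fin m → ℝ) :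
    ∃ (w : Bool → Fin (m + 2) → ℝ) (c : Fin m → ℝ), (∀ b i, 0 ≤ w b i) ∧
      (∀ b b' i, b ≠ b' → w b i * w b' i = 0) ∧ (∀ b, ∑ i, w b i = 1) ∧
      ∀ b, ∑ i, w b i • f i = c := by
  have hf : ¬ AffineIndependent ℝ f := fun h => by
    have h1 := h.card_le_finrank_succ
    have h2 := Submodule.finrank_le (vectorSpan ℝ (Set.range f))
    simp only [Fintype.card_fin, Module.finrank_fin_fun] at h1 h2
    omega
  obtain ⟨I, c, hc, hc'⟩ := Convex.radon_partition hf
  obtain ⟨w, h0, hI, h1, hw⟩ := exists_weights_of_mem_convexHull_image hc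
  obtain ⟨w', h0', hI', h1', hw'⟩ := exists_weights_of_mem_convexHull_image hc'
  have hww : ∀ i, w i * w' i = 0 := fun i => by
    by_cases hi : i ∈ I
    · rw [hI' i (by simpa using hi), mul_zero]
    · rw [hI i hi, zero_mul]
  refine ⟨fun b => cond b w w', c, ?_, ?_, ?_, ?_⟩
  · rintro (_ | _) i
    exacts [h0' i, h0 i]
  · rintro (_ | _) (_ | _) i h
    exacts [absurd rfl h, (mul_comm _ _).trans (hww i), hww i, absurd rfl h]
  · rintro (_ | _)
    exacts [h1', h1]
  · rintro (_ | _)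
    exacts [hw', hw]

/-- In infinite dimensions, tuples of self-adjoint operators have scalar compressions of any
finite size, orthogonally to any finite-dimensional subspace. -/
theorem exists_scalar_block [CompleteSpace H] (hH : ¬ FiniteDimensional ℂ H) {m : ℕ}
    {A : Fin m → H →L[ℂ] H} (hA : ∀ j, IsSelfAdjoint (A j)) (n : ℕ) (M : Submodule ℂ H)
    [FiniteDimensional ℂ M] :
    ∃ y : Fin n → H, (∀ s, y s ∈ Mᗮ) ∧ ∃ d : Fin m → ℝ,
      Realizes A (fun j => (d j : ℂ) • (1 : Matrix (Fin n) (Fin n) ℂ)) y := by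
  -- The inductive step doubles the block size, and `2 * n ≥ n + 1` needs `n ≥ 1`.
  rcases Nat.eq_zero_or_pos n with rfl | hn
  · exact ⟨Fin.elim0, fun s => s.elim0, 0, ⟨fun s => s.elim0, fun s => s.elim0⟩,
      fun _ s => s.elim0⟩
  induction n, hn using Nat.le_induction generalizing M with
  | base =>
    obtain ⟨y, hyM, hy⟩ := exists_unit_mem_orthogonal hH M
    refine ⟨fun _ => y, fun _ => hyM, fun j => RCLike.re (inner ℂ y (A j y)), ?_, ?_⟩
    · exact ⟨fun _ => hy, fun s t h => absurd (Subsingleton.elim s t) h⟩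
    · intro j s t
      rw [Subsingleton.elim s t]
      have : inner ℂ (A j y) y = inner ℂ y (A j y) := (hA j).isSymmetric.apply_clm y y
      simp only [Matrix.smul_apply, Matrix.one_apply_eq, smul_eq_mul, mul_one]
      refine (Complex.conj_eq_iff_re.1 ?_).symm
      rw [inner_conj_symm, this]
  | succ n hn ih =>
    -- The scalars `d` may vary from block to block. A Radon partition of those of `m + 2` blocks
    -- gives two disjointly supported convex combinations with the same value `c`.
    obtain ⟨x, hxM, hx, ho, hxA⟩ := exists_seq_blocks hA
      (P := fun x : Fin n → H => ∃ d : Fin m → ℝ,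
        Realizes A (fun j => (d j : ℂ) • (1 : Matrix (Fin n) (Fin n) ℂ)) x) (fun M _ => ih M) M
    choose d hd using hx
    obtain ⟨w, c, hw0, hww, hw1, hwc⟩ := exists_radon_weights (fun i : Fin (m + 2) => d i)
    -- Square roots of the weights make each `z b` orthonormal with scalars `c`; disjoint supports
    -- remove the cross terms between the two.
    let z : Bool → Fin n → H := fun b s => ∑ i : Fin (m + 2), ((√(w b i) : ℝ) : ℂ) • x i s
    have hcoef : ∀ b b' i, star ((√(w b i) : ℝ) : ℂ) * ((√(w b' i) : ℝ) : ℂ) =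
        if b = b' then (w b i : ℂ) else 0 := fun b b' i => by
      rw [← starRingEnd_apply, Complex.conj_ofReal, ← Complex.ofReal_mul]
      split_ifs with h
      · subst h
        rw [Real.mul_self_sqrt (hw0 b i)]
      · rw [← Real.sqrt_mul (hw0 b i), hww b b' i h, Real.sqrt_zero, Complex.ofReal_zero]
    have hz : ∀ (T : H →L[ℂ] H) (s t : Fin n) (e : Fin (m + 2) → ℂ),
        (∀ i : Fin (m + 2), inner ℂ (x i s) (T (x i t)) = e i) →
        (∀ i i' : ℕ, i ≠ i' → inner ℂ (x i s) (T (x i' t)) = 0) → ∀ b b',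
        inner ℂ (z b s) (T (z b' t)) = if b = b' then ∑ i, (w b i : ℂ) * e i else 0 := by
      intro T s t e hd ho b b'
      have := inner_sum_smul_of_offDiag T (x := fun i : Fin (m + 2) => x i s)
        (y := fun i : Fin (m + 2) => x i t) hd (fun i i' h => ho i i' (Fin.val_ne_of_ne h))
        (fun i => ((√(w b i) : ℝ) : ℂ)) (fun i => ((√(w b' i) : ℝ) : ℂ))
      simp only [hcoef] at this
      rw [this]
      split_ifs <;> simp
    have hzo : ∀ b b' s t, inner ℂ (z b s) (z b' t) =
        if b = b' then if s = t then 1 else 0 else 0 := fun b b' s t => by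
      have := hz (ContinuousLinearMap.id ℂ H) s t (fun _ => if s = t then 1 else 0)
        (fun i => orthonormal_iff_ite.1 (hd i).1 s t) (fun i i' h => ho i i' s t h) b b'
      rw [← Finset.sum_mul, ← Complex.ofReal_sum, hw1, Complex.ofReal_one, one_mul] at this
      exact this
    have hzA : ∀ j b b' s t, inner ℂ (z b s) (A j (z b' t)) =
        if b = b' then ((c j : ℂ) • (1 : Matrix (Fin n) (Fin n) ℂ)) s t else 0 :=
      fun j b b' s t => by
      have := hz (A j) s t (fun i => ((d i j : ℂ) • (1 : Matrix (Fin n) (Fin n) ℂ)) s t)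
        (fun i => (hd i).2 j s t) (fun i i' h => hxA j i i' s t h) b b'
      rw [this, ← hwc b]
      simp [Finset.sum_apply, Finset.sum_mul, mul_assoc]
    have hzM : ∀ b s, z b s ∈ Mᗮ := fun b s =>
      sum_mem fun i _ => smul_mem _ _ (hxM i s)
    have hreal := realizes_one_kronecker (A := A)
      (C := fun j => (c j : ℂ) • (1 : Matrix (Fin n) (Fin n) ℂ)) (x := z)
      (fun b => ⟨orthonormal_iff_ite.2 fun s t => by simpa using hzo b b s t,
        fun j s t => by simpa using hzA j b b s t⟩)
      (fun b b' s t h => by simp [hzo, h]) (fun j b b' s t h => by simp [hzA, h])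
    obtain ⟨e⟩ : Nonempty (Fin (n + 1) ↪ Bool × Fin n) :=
      Function.Embedding.nonempty_of_card_le (by simp; omega)
    refine ⟨(fun p : Bool × Fin n => z p.1 p.2) ∘ e, fun s => hzM (e s).1 (e s).2, c, ?_⟩
    have := hreal.restrict e.injective
    convert this using 1
    ext j s t
    rw [Matrix.submatrix_apply, Matrix.kroneckerMap_apply]
    by_cases h : s = t
    · subst h
      simp
    · have h' : e s ≠ e t := e.injective.ne h
      rw [Ne, Prod.ext_iff, not_and_or] at h'
      rcases h' with h' | h' <;> simp [h, h']

-- Recovering blocks from perturbations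

theorem realizableAwayFromFinite_of_forall_add [CompleteSpace H]
    (hH : ¬ FiniteDimensional ℂ H) {m p q : ℕ} (hp : 1 ≤ p)
    {A : Fin m → H →L[ℂ] H} (hA : ∀ j, IsSelfAdjoint (A j))
    {B : Fin m → Matrix (Fin q) (Fin q) ℂ}
    (hB : ∀ F : Fin m → H →L[ℂ] H, (∀ j, IsFiniteRankSelfAdjoint (F j)) →
      B ∈ Lam p q (fun j => A j + F j)) : RealizableAwayFromFinite A B := by
  intro M hM
  obtain ⟨y, hyM, d, hy⟩ := exists_scalar_block hH hA q M
  let N : Submodule ℂ H := M ⊔ (span ℂ (Set.range y) ⊔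
    span ℂ (Set.range fun p : Fin m × Fin q => A p.1 (y p.2)))
  have hN : FiniteDimensional ℂ N := by
    have h1 := FiniteDimensional.span_of_finite ℂ (Set.finite_range y)
    have h2 := FiniteDimensional.span_of_finite ℂ
      (Set.finite_range fun p : Fin m × Fin q => A p.1 (y p.2))
    have h3 := Submodule.finiteDimensional_sup (span ℂ (Set.range y))
      (span ℂ (Set.range fun p : Fin m × Fin q => A p.1 (y p.2)))
    exact Submodule.finiteDimensional_sup _ _
  have hyN : ∀ k, y k ∈ N := fun k => mem_sup_right (mem_sup_left (subset_span ⟨k, rfl⟩))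
  have hAyN : ∀ j k, A j (y k) ∈ N := fun j k =>
    mem_sup_right (mem_sup_right (subset_span ⟨(j, k), rfl⟩))
  let Q : H →L[ℂ] H := N.starProjection
  have hQ : ∀ u v, inner ℂ (Q u) v = inner ℂ u (Q v) :=
    fun u v => inner_starProjection_left_eq_right N u v
  have hQQ : ∀ u, Q (Q u) = Q u := fun u =>
    starProjection_eq_self_iff.2 (starProjection_apply_mem N u)
  let P : H →L[ℂ] H := 1 - Q
  have hP : ∀ u v, inner ℂ (P u) v = inner ℂ u (P v) := fun u v => by
    simp [P, hQ]
  have hPN : ∀ u, P u ∈ Nᗮ := fun u => sub_starProjection_mem_orthogonal u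
  -- Chosen so that `A j + F j = P * A j * P + d j • Q`; the rank is finite because `P` differs from
  -- the identity by the finite-rank `Q`.
  let F : Fin m → H →L[ℂ] H := fun j => P * A j * P + (d j : ℂ) • Q - A j
  have hF : ∀ j, IsFiniteRankSelfAdjoint (F j) := fun j => by
    constructor
    · rw [ContinuousLinearMap.isSelfAdjoint_iff_isSymmetric]
      intro u v
      have hAs := (hA j).isSymmetric.apply_clm
      simp only [F, ContinuousLinearMap.coe_coe, _root_.sub_apply, _root_.add_apply,
        _root_.smul_apply, mul_apply_eq_comp, inner_sub_left, inner_sub_right, inner_add_left,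
        inner_add_right, inner_smul_left, inner_smul_right, Complex.conj_ofReal, hP, hQ, hAs]
    · have : FiniteDimensional ℂ (N ⊔ N.map (A j : H →ₗ[ℂ] H) : Submodule ℂ H) :=
        Submodule.finiteDimensional_sup _ _
      refine Submodule.finiteDimensional_of_le (S₂ := N ⊔ N.map (A j : H →ₗ[ℂ] H)) ?_
      rintro _ ⟨u, rfl⟩
      have : F j u = (-Q (A j (P u)) + (d j : ℂ) • Q u) + -A j (Q u) := by
        simp only [F, P, _root_.sub_apply, _root_.add_apply, _root_.smul_apply,
          mul_apply_eq_comp, one_apply_eq_self, map_sub]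
        abel
      change F j u ∈ _
      rw [this]
      have hQN : ∀ u, Q u ∈ N := fun u => starProjection_apply_mem N u
      exact add_mem (mem_sup_left (add_mem (neg_mem (hQN _)) (smul_mem _ _ (hQN _))))
        (mem_sup_right (neg_mem (mem_map_of_mem (hQN u))))
  obtain ⟨x, hxo, hxA⟩ := exists_block_of_mem_Lam_of_pos hp (hB F hF)
  -- Factoring the Gram matrix of the `Q (x s)` gives coordinates, in the orthonormal family `y`, of
  -- vectors `u s` with the same Gram matrix. Replacing `Q (x s)` by `u s` keeps all inner products
  -- and makes the family orthogonal to `M`.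
  obtain ⟨C, hC⟩ : ∃ C : Matrix (Fin q) (Fin q) ℂ,
      Matrix.gram ℂ (fun s => Q (x s)) = C.conjTranspose * C := by
    open scoped MatrixOrder in
    exact CStarAlgebra.nonneg_iff_eq_star_mul_self.1
      (Matrix.posSemidef_gram ℂ fun s => Q (x s)).nonneg
  have hgram : ∀ s t, ∑ k, star (C k s) * C k t = inner ℂ (Q (x s)) (Q (x t)) := fun s t =>
    (congrFun (congrFun hC s) t).symm
  let u : Fin q → H := fun s => ∑ k, C k s • y k
  have huN : ∀ s, u s ∈ N := fun s => sum_mem fun k _ => smul_mem _ _ (hyN k)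
  have hAuN : ∀ j s, A j (u s) ∈ N := fun j s => by
    simp only [u, map_sum, map_smul]
    exact sum_mem fun k _ => smul_mem _ _ (hAyN j k)
  have huu : ∀ s t, inner ℂ (u s) (u t) = inner ℂ (Q (x s)) (Q (x t)) := fun s t => by
    have hyo := orthonormal_iff_ite.1 hy.1
    have := inner_sum_smul_of_offDiag (ContinuousLinearMap.id ℂ H) (x := y) (y := y)
      (c := fun _ => 1) (fun i => by simpa using hyo i i)
      (fun i i' h => by simpa [h] using hyo i i') (fun k => C k s) (fun k => C k t)
    rw [← Finset.sum_mul, hgram, mul_one] at this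
    exact this
  have huAu : ∀ j s t, inner ℂ (u s) (A j (u t)) = inner ℂ (Q (x s)) (Q (x t)) * d j :=
    fun j s t => by
    have := inner_sum_smul_of_offDiag (A j) (x := y) (y := y)
      (c := fun _ => (d j : ℂ)) (fun i => by simpa using hy.2 j i i)
      (fun i i' h => by simpa [h] using hy.2 j i i') (fun k => C k s) (fun k => C k t)
    rw [← Finset.sum_mul, hgram] at this
    exact this
  have hNP : ∀ v ∈ N, ∀ w, inner ℂ v (P w) = 0 := fun v hv w =>
    (mem_orthogonal _ _).1 (hPN w) v hv
  have hPNz : ∀ v ∈ N, ∀ w, inner ℂ (P w) v = 0 := fun v hv w =>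
    inner_eq_zero_symm.1 (hNP v hv w)
  -- This is why `N` also contains the images `A j (y k)`.
  have huAP : ∀ j s w, inner ℂ (u s) (A j (P w)) = 0 := fun j s w => by
    rw [← (hA j).isSymmetric.apply_clm]
    exact hNP _ (hAuN j s) w
  refine ⟨fun s => u s + P (x s), fun s => ?_, orthonormal_iff_ite.2 fun s t => ?_,
    fun j s t => ?_⟩
  · exact add_mem (sum_mem fun k _ => smul_mem _ _ (hyM k))
      (orthogonal_le le_sup_left (hPN (x s)))
  · rw [inner_add_left, inner_add_right, inner_add_right, huu, hNP _ (huN s),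
      hPNz _ (huN t), ← orthonormal_iff_ite.1 hxo s t]
    have hsplit : ∀ v, v = Q v + P v := fun v => by simp [P]
    have hQN : ∀ u, Q u ∈ N := fun u => starProjection_apply_mem N u
    conv_rhs => rw [hsplit (x s), hsplit (x t)]
    rw [inner_add_left, inner_add_right, inner_add_right, hNP _ (hQN _), hPNz _ (hQN _)]
  · rw [map_add, inner_add_left, inner_add_right, inner_add_right, huAu, huAP,
      hPNz _ (hAuN j t), ← hxA j s t]
    have hAF : (A j + F j) (x t) = P (A j (P (x t))) + (d j : ℂ) • Q (x t) := by
      simp only [F, _root_.sub_apply, _root_.add_apply, _root_.smul_apply,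
        mul_apply_eq_comp]
      abel
    rw [hAF, inner_add_right, inner_smul_right, ← hP, hQ, hQQ]
    ring

-- Conclusion

theorem starCenters_subset {V : Type*} [AddCommGroup V] [Module ℝ V] (S : Set V) :
    starCenters S ⊆ S := fun _ h => h.1

end MatricialRange

theorem theorem3p2 {H : Type*} [NormedAddCommGroup H] [InnerProductSpace ℂ H] [CompleteSpace H]
    (hH : ¬ FiniteDimensional ℂ H) {m : ℕ} (q : ℕ) (hq : 1 ≤ q) (p₀ : ℕ) (hp₀ : 1 ≤ p₀)
    (A : Fin m → H →L[ℂ] H) (hA : ∀ j, IsSelfAdjoint (A j)) :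
    (MatricialRange.LamInfty q A =
        (⋂ (p : ℕ) (_ : 1 ≤ p), MatricialRange.starCenters (MatricialRange.Lam p q A))) ∧
    (MatricialRange.LamInfty q A =
        (⋂ (p : ℕ) (_ : 1 ≤ p), MatricialRange.Lam p q A)) ∧
    (MatricialRange.LamInfty q A =
        (⋂ (L : Submodule ℂ H) (Y : Lᗮ →L[ℂ] H) (_ : MatricialRange.IsFiniteCodimIsometry L Y),
          MatricialRange.Lam p₀ q (fun j => MatricialRange.compression Y (A j)))) ∧
    (MatricialRange.LamInfty q A =
        (⋂ (F : Fin m → H →L[ℂ] H) (_ : ∀ j, MatricialRange.IsFiniteRankSelfAdjoint (F j)),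
          MatricialRange.Lam p₀ q (fun j => A j + F j))) ∧
    Convex ℝ (MatricialRange.LamInfty q A) := by
  have hforall := fun B => mem_LamInfty_iff_forall_mem_Lam (q := q) hA (B := B)
  have hstar := fun p => LamInfty_subset_starCenters p q hA
  refine ⟨?_, ?_, ?_, ?_, ?_⟩
  · refine Set.Subset.antisymm (Set.subset_iInter₂ fun p _ => hstar p) fun B hB => ?_
    exact (hforall B).2 fun p hp => starCenters_subset _ (Set.mem_iInter₂.1 hB p hp)
  · ext B
    rw [hforall, Set.mem_iInter₂]
  · refine Set.Subset.antisymm (Set.subset_iInter fun L => Set.subset_iInter₂ fun Y hY =>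
      LamInfty_subset_Lam_compression p₀ q hA hY) fun B hB => ?_
    refine (mem_LamInfty_iff hA).2
      (realizableAwayFromFinite_of_forall_compression hH hp₀ fun L Y hY => ?_)
    exact Set.mem_iInter₂.1 (Set.mem_iInter.1 hB L) Y hY
  · refine Set.Subset.antisymm (Set.subset_iInter₂ fun F hF =>
      LamInfty_subset_Lam_add p₀ q hA hF) fun B hB => ?_
    exact (mem_LamInfty_iff hA).2
      (realizableAwayFromFinite_of_forall_add hH hp₀ hA fun F hF => Set.mem_iInter₂.1 hB F hF)
  -- `B` is a star-center of every `Lam p q A` and `C` lies in all of them, so the segment stays in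
  -- their intersection.
  · intro B hB C hC a b ha hb hab
    refine (hforall _).2 fun p hp => ?_
    have := (hstar p hB).2 C ((hforall C).1 hC p hp) a ha (by linarith)
    rwa [← hab, add_sub_cancel_left] at this
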